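/- For $s\ge 1$ let $\gamma^{(s)}(\mathbb{R})$ be the Gevrey class of order $s$: the set of $f\in C^\infty(\mathbb{R};\mathbb{C})$ such that for every compact $K\subset\mathbb{R}$ there are $C,h>0$ with $|f^{(k)}(x)|\le C\,h^{-k}(k!)^s$ for all $x\in K$ and $k\in\mathbb{N}$. For complex-valued functions $u(t,x)$ consider the Cauchy problem $$\partial_t^2u+i\,\partial_xu=0,\qquad u(0,x)=\varphi_0(x),\quad \partial_tu(0,x)=\varphi_1(x).\tag{1}$$ Given a class $A$ of functions on $\mathbb{R}$, problem (1) is called locally solvable in $A$ at the origin if for all $\varphi_0,\varphi_1\in A$ there are a neighborhood $U$ of the origin of $\mathbb{R}^2$ (possibly depending on $\varphi_0,\varphi_1$) and a function $u\in C^\infty(U)$ such that $\partial_t^2u+i\,\partial_xu=0$ in $U$ and $u(0,x)=\varphi_0(x)$, $\partial_tu(0,x)=\varphi_1(x)$ whenever $(0,x)\in U$. **Theorem.** If $s>2$, then the Cauchy problem (1) is not locally solvable in $\gamma^{(s)}(\mathbb{R})$ at the origin. In particular, it is not $C^\infty$-solvable: it is not locally solvable in $C^\infty(\mathbb{R})$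 at the origin, and for every $T>0$ there are $\varphi_0,\varphi_1\in C^\infty(\mathbb{R})$ for which (1) has no solution $u\in C^\infty([0,T]\times\mathbb{R})$ on $[0,T]\times\mathbb{R}$. -/

import Mathlib

open scoped ContDiff

/-- The class `C^∞(ℝ)` of smooth complex-valued functions on the line. -/
def smoothClass : Set (ℝ → ℂ) :=
  {f | ContDiff ℝ ∞ f}

/-- The Gevrey class `γ^{(s)}(ℝ)`: smooth functions `f` such that on every compact set `K`
there are `C, h > 0` with `|f^{(k)}(x)| ≤ C h^{-k} (k!)^s` for all `x ∈ K` and all `k`. -/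
def gevreyClass (s : ℝ) : Set (ℝ → ℂ) :=
  {f | ContDiff ℝ ∞ f ∧
    ∀ K : Set ℝ, IsCompact K →
      ∃ C h : ℝ, 0 < C ∧ 0 < h ∧
        ∀ x ∈ K, ∀ k : ℕ, ‖iteratedDeriv k f x‖ ≤ C * h⁻¹ ^ k * (k.factorial : ℝ) ^ s}

/-- The operator `P = ∂_t² + i ∂_x` acting on functions of `(t, x)`. -/
noncomputable def modelOperator (u : ℝ × ℝ → ℂ) (p : ℝ × ℝ) : ℂ :=
  iteratedDeriv 2 (fun t : ℝ => u (t, p.2)) p.1 +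
    Complex.I * deriv (fun x : ℝ => u (p.1, x)) p.2

/-- Local solvability at the origin, for initial data in the class `A`, of the Cauchy problem
`P u = 0`, `u(0, x) = φ₀(x)`, `∂_t u(0, x) = φ₁(x)` with data on the line `t = 0`: for all
`φ₀, φ₁ ∈ A` there are an open neighborhood `U` of the origin of `ℝ²`, which may depend on the
data, and a function `u ∈ C^∞(U)` which solves the problem in `U`. -/
def LocallySolvableAtOrigin (P : (ℝ × ℝ → ℂ) → ℝ × ℝ → ℂ) (A : Set (ℝ → ℂ)) : Prop :=
  ∀ φ₀ ∈ A, ∀ φ₁ ∈ A,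
    ∃ U : Set (ℝ × ℝ), IsOpen U ∧ (0, 0) ∈ U ∧
      ∃ u : ℝ × ℝ → ℂ, ContDiffOn ℝ ∞ u U ∧
        (∀ p ∈ U, P u p = 0) ∧
        ∀ x : ℝ, (0, x) ∈ U →
          u (0, x) = φ₀ x ∧ deriv (fun t : ℝ => u (t, x)) 0 = φ₁ x

/-- Solvability in `C^∞` of the Cauchy problem `∂_t² u + i ∂_x u = 0`, `u(0, x) = φ₀(x)`,
`∂_t u(0, x) = φ₁(x)` on the closed strip `[0, T] × ℝ`: for all `φ₀, φ₁ ∈ C^∞(ℝ)` there is a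
solution which is smooth up to the boundary. The derivatives in `t` are one-sided at `t = 0`
and at `t = T`. -/
def SmoothlySolvableOnStrip (T : ℝ) : Prop :=
  ∀ φ₀ ∈ smoothClass, ∀ φ₁ ∈ smoothClass,
    ∃ u : ℝ × ℝ → ℂ, ContDiffOn ℝ ∞ u (Set.Icc 0 T ×ˢ Set.univ) ∧
      (∀ t ∈ Set.Icc 0 T, ∀ x : ℝ,
        iteratedDerivWithin 2 (fun τ : ℝ => u (τ, x)) (Set.Icc 0 T) t +
          Complex.I * deriv (fun y : ℝ => u (t, y)) x = 0) ∧
      ∀ x : ℝ, u (0, x) = φ₀ x ∧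
        derivWithin (fun τ : ℝ => u (τ, x)) (Set.Icc 0 T) 0 = φ₁ x

/-!
A solution with datum `e ^ {iξx}`, `ξ > 0`, and zero velocity is `cosh (t √ξ) e ^ {iξx}`. The datum
`φ = ∑ⱼ e ^ {-j} e ^ {i jˢ x}` is of Gevrey order `s`, but the `j`-th component of a solution with
this datum should grow to `e ^ {-j} cosh (t j ^ {s/2})`, which is unbounded for `s > 2`.

To make this rigorous for a solution `u` defined near the origin only, test `u (t, ·)` against
`χ e ^ {-i mˢ x}`, where `χ` is a cutoff of Gevrey order 2 whose Fourier transform is nonnegative: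
then all other components contribute with the right sign. Since `∂_t ^ 2 u = -i ∂_x u`, the Taylor
coefficients in `t` of this moment are obtained by moving all `x`-derivatives to the test function.
They grow like `(k!) ^ 2`, against the `(2k)!` of the Taylor expansion, so for small `t` the
expansion converges, and it bounds `e ^ {-m} cosh (t m ^ {s/2})` independently of `m`.
-/

open Set Filter Topology MeasureTheory
open scoped Nat FourierTransform ComplexConjugate Convolution

/-- Smooth functions on the line whose derivatives satisfy the Gevrey estimates of order `s` with
the same constants at all points; `a` is the inverse of the radius `h` in `gevreyClass`. -/
structure UniformGevrey {E : Type*} [NormedAddCommGroup E] [NormedSpace ℝ E] (s a : ℝ)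
    (f : ℝ → E) : Prop where
  contDiff : ContDiff ℝ ∞ f
  exists_bound : ∃ C, 0 ≤ C ∧ ∀ k x, ‖iteratedDeriv k f x‖ ≤ C * a ^ k * (k ! : ℝ) ^ s

theorem factorial_rpow_mul_factorial_rpow_le {s : ℝ} (hs : 0 ≤ s) {n i : ℕ} (hi : i ≤ n) :
    (i ! : ℝ) ^ s * ((n - i)! : ℝ) ^ s ≤ (n ! : ℝ) ^ s := by
  rw [← Real.mul_rpow (by positivity) (by positivity)]
  refine Real.rpow_le_rpow (by positivity) ?_ hs
  exact_mod_cast Nat.le_of_dvd (Nat.factorial_pos n) (Nat.factorial_mul_factorial_dvd_factorial hi)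

namespace UniformGevrey

section NormedSpace

variable {E : Type*} [NormedAddCommGroup E] [NormedSpace ℝ E] {s a : ℝ} {f : ℝ → E}

theorem zero : UniformGevrey s a (0 : ℝ → E) where
  contDiff := contDiff_zero_fun
  exists_bound := ⟨0, le_rfl, fun k x => by
    simp [show iteratedDeriv k (0 : ℝ → E) x = 0 from iteratedDeriv_const_zero]⟩

theorem comp_const_add (h : UniformGevrey s a f) (c : ℝ) :
    UniformGevrey s a fun x => f (c + x) := by
  obtain ⟨C, hC, hf⟩ := h.exists_bound
  refine ⟨h.contDiff.comp (contDiff_const.add contDiff_id), C, hC, fun k x => ?_⟩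
  rw [iteratedDeriv_comp_const_add]
  exact hf k _

theorem comp_neg (h : UniformGevrey s a f) : UniformGevrey s a fun x => f (-x) := by
  obtain ⟨C, hC, hf⟩ := h.exists_bound
  refine ⟨h.contDiff.comp contDiff_neg, C, hC, fun k x => ?_⟩
  rw [iteratedDeriv_comp_neg, norm_smul, norm_pow, norm_neg, norm_one, one_pow, one_mul]
  exact hf k _

end NormedSpace

theorem mul {A : Type*} [NormedRing A] [NormedAlgebra ℝ A] {s a b : ℝ} {f g : ℝ → A}
    (hf : UniformGevrey s a f) (hg : UniformGevrey s b g) (hs : 0 ≤ s) (ha : 0 ≤ a) (hb : 0 ≤ b) :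
    UniformGevrey s (a + b) fun x => f x * g x := by
  obtain ⟨C, hC, hfC⟩ := hf.exists_bound
  obtain ⟨D, hD, hgD⟩ := hg.exists_bound
  refine ⟨hf.contDiff.mul hg.contDiff, C * D, by positivity, fun n x => ?_⟩
  have leibniz := norm_iteratedFDeriv_mul_le (𝕜 := ℝ) hf.contDiff hg.contDiff x (n := n)
    (by exact_mod_cast le_top)
  simp only [norm_iteratedFDeriv_eq_norm_iteratedDeriv] at leibniz
  have hterm : ∀ i ≤ n, n.choose i * ‖iteratedDeriv i f x‖ * ‖iteratedDeriv (n - i) g x‖ ≤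
      C * D * (n ! : ℝ) ^ s * (a ^ i * b ^ (n - i) * n.choose i) := fun i hi =>
    calc n.choose i * ‖iteratedDeriv i f x‖ * ‖iteratedDeriv (n - i) g x‖
        ≤ n.choose i * (C * a ^ i * (i ! : ℝ) ^ s) * (D * b ^ (n - i) * ((n - i)! : ℝ) ^ s) := by
          gcongr
          exacts [hfC i x, hgD (n - i) x]
      _ = C * D * ((i ! : ℝ) ^ s * ((n - i)! : ℝ) ^ s) *
          (a ^ i * b ^ (n - i) * n.choose i) := by ring
      _ ≤ C * D * (n ! : ℝ) ^ s * (a ^ i * b ^ (n - i) * n.choose i) := by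
          gcongr
          exact factorial_rpow_mul_factorial_rpow_le hs hi
  calc ‖iteratedDeriv n (fun x => f x * g x) x‖
      ≤ ∑ i ∈ Finset.range (n + 1),
          n.choose i * ‖iteratedDeriv i f x‖ * ‖iteratedDeriv (n - i) g x‖ := leibniz
    _ ≤ ∑ i ∈ Finset.range (n + 1),
          C * D * (n ! : ℝ) ^ s * (a ^ i * b ^ (n - i) * n.choose i) :=
        Finset.sum_le_sum fun i hi => hterm i (Nat.lt_succ_iff.mp (Finset.mem_range.mp hi))
    _ = C * D * (a + b) ^ n * (n ! : ℝ) ^ s := by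
        rw [← Finset.mul_sum, ← add_pow]
        ring

theorem star {s a : ℝ} {f : ℝ → ℂ} (h : UniformGevrey s a f) :
    UniformGevrey s a fun x => conj (f x) := by
  obtain ⟨C, hC, hf⟩ := h.exists_bound
  refine ⟨Complex.conjCLE.contDiff.comp h.contDiff, C, hC, fun k x => ?_⟩
  rw [← norm_iteratedFDeriv_eq_norm_iteratedDeriv]
  refine (Complex.conjLIE.norm_iteratedFDeriv_comp_left f x k).trans_le ?_
  rw [norm_iteratedFDeriv_eq_norm_iteratedDeriv]
  exact hf k x

theorem mem_gevreyClass {s a : ℝ} {f : ℝ → ℂ} (h : UniformGevrey s a f) (ha : 0 < a) :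
    f ∈ gevreyClass s := by
  obtain ⟨C, hC, hf⟩ := h.exists_bound
  refine ⟨h.contDiff, fun K _ => ⟨C + 1, a⁻¹, by positivity, by positivity, fun x _ k => ?_⟩⟩
  rw [inv_inv]
  refine (hf k x).trans ?_
  gcongr
  linarith

end UniformGevrey

theorem iteratedDeriv_comp_ofReal {F : ℂ → ℂ} (k : ℕ) {x : ℝ} (hF : AnalyticAt ℂ F x) :
    iteratedDeriv k (fun y : ℝ => F y) x = iteratedDeriv k F x := by
  induction k generalizing x with
  | zero => simp
  | succ k ih =>
    have hdiff : DifferentiableAt ℂ (iteratedDeriv k F) x := by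
      rw [iteratedDeriv_eq_iterate]
      exact (hF.iterated_deriv k).differentiableAt
    have hnear : ∀ᶠ y : ℝ in 𝓝 x, AnalyticAt ℂ F y :=
      Complex.continuous_ofReal.continuousAt.eventually hF.eventually_analyticAt
    rw [iteratedDeriv_succ, iteratedDeriv_succ, ← hdiff.hasDerivAt.comp_ofReal.deriv]
    exact EventuallyEq.deriv_eq (hnear.mono fun y hy => ih hy)

theorem norm_cexp_I_mul_ofReal_mul (ξ x : ℝ) : ‖Complex.exp (Complex.I * ξ * x)‖ = 1 := by
  simp [Complex.norm_exp]

theorem contDiff_cexp_I_mul (ξ : ℝ) : ContDiff ℝ ∞ fun x : ℝ => Complex.exp (Complex.I * ξ * x) :=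
  (contDiff_const.mul Complex.ofRealCLM.contDiff).cexp

theorem iteratedDeriv_cexp_I_mul (ξ : ℝ) (k : ℕ) (x : ℝ) :
    iteratedDeriv k (fun x : ℝ => Complex.exp (Complex.I * ξ * x)) x =
      (Complex.I * ξ) ^ k * Complex.exp (Complex.I * ξ * x) := by
  rw [iteratedDeriv_comp_ofReal (F := fun z => Complex.exp (Complex.I * ξ * z)) k (by fun_prop),
    iteratedDeriv_cexp_const_mul]

theorem norm_iteratedDeriv_cexp_I_mul (ξ : ℝ) (k : ℕ) (x : ℝ) :
    ‖iteratedDeriv k (fun x : ℝ => Complex.exp (Complex.I * ξ * x)) x‖ = |ξ| ^ k := by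
  rw [iteratedDeriv_cexp_I_mul, norm_mul, norm_cexp_I_mul_ofReal_mul]
  simp

theorem pow_le_exp_div_mul {r a : ℝ} (hr : 0 ≤ r) (ha : 0 < a) (k : ℕ) :
    r ^ k ≤ Real.exp (r / a) * a ^ k * k ! := by
  have h := Real.pow_div_factorial_le_exp (r / a) (by positivity) k
  rw [div_le_iff₀ (by positivity), div_pow, div_le_iff₀ (by positivity)] at h
  linarith

theorem uniformGevrey_cexp_I_mul {s a : ℝ} (hs : 1 ≤ s) (ha : 0 < a) (ξ : ℝ) :
    UniformGevrey s a fun x : ℝ => Complex.exp (Complex.I * ξ * x) := by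
  refine ⟨contDiff_cexp_I_mul ξ, Real.exp (|ξ| / a), by positivity, fun k x => ?_⟩
  rw [norm_iteratedDeriv_cexp_I_mul]
  refine (pow_le_exp_div_mul (abs_nonneg ξ) ha k).trans ?_
  gcongr
  exact Real.self_le_rpow_of_one_le (by exact_mod_cast Nat.factorial_pos k) hs

theorem two_div_le_re_inv {x : ℝ} (hx : 0 < x) {z : ℂ} (hz : ‖z - x‖ ≤ x / 2) :
    2 / (9 * x) ≤ (z⁻¹).re := by
  have hre : x / 2 ≤ z.re := by
    have h := (Complex.abs_re_le_norm (z - x)).trans hz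
    rw [Complex.sub_re, Complex.ofReal_re] at h
    linarith [(abs_le.mp h).1]
  have hpos : 0 < ‖z‖ := (by linarith : 0 < z.re).trans_le (Complex.re_le_norm z)
  have hle : ‖z‖ ≤ 3 * x / 2 := by
    have h : ‖z‖ ≤ ‖z - x‖ + ‖(x : ℂ)‖ := by simpa using norm_add_le (z - x) (x : ℂ)
    rw [Complex.norm_of_nonneg hx.le] at h
    linarith
  rw [Complex.inv_re, Complex.normSq_eq_norm_sq, div_le_div_iff₀ (by positivity) (by positivity)]
  nlinarith [mul_le_mul hle hle hpos.le (by positivity)]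

-- Cauchy's estimate on the disc of radius `x / 2` gives `k! (2 / x) ^ k exp (-2 / (9 x))`, and the
-- exponential factor turns the negative power of `x` into a second factorial.
theorem norm_iteratedDeriv_cexp_neg_inv_le (k : ℕ) {x : ℝ} (hx : 0 < x) :
    ‖iteratedDeriv k (fun z : ℂ => Complex.exp (-z⁻¹)) x‖ ≤ 9 ^ k * (k ! : ℝ) ^ 2 := by
  have hdist : ∀ z ∈ Metric.closedBall (x : ℂ) (x / 2), ‖z - x‖ ≤ x / 2 := fun z hz =>
    mem_closedBall_iff_norm.mp hz
  have hbound : ∀ z ∈ Metric.sphere (x : ℂ) (x / 2),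
      ‖Complex.exp (-z⁻¹)‖ ≤ Real.exp (-(2 / (9 * x))) := fun z hz => by
    rw [Complex.norm_exp, Real.exp_le_exp, Complex.neg_re, neg_le_neg_iff]
    exact two_div_le_re_inv hx (hdist z (Metric.sphere_subset_closedBall hz))
  have hdiff : DiffContOnCl ℂ (fun z : ℂ => Complex.exp (-z⁻¹)) (Metric.ball x (x / 2)) := by
    apply DifferentiableOn.diffContOnCl
    rw [closure_ball _ (by positivity)]
    intro z hz
    have hne : z ≠ 0 := by
      rintro rfl
      have : (0 : ℝ) < 2 / (9 * x) := by positivity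
      simpa using this.trans_le (two_div_le_re_inv hx (hdist 0 hz))
    exact (differentiableAt_inv hne).neg.cexp.differentiableWithinAt
  have hcauchy := Complex.norm_iteratedDeriv_le_of_forall_mem_sphere_norm_le k (by positivity)
    hdiff hbound
  have hexp : (2 / x) ^ k ≤ Real.exp (2 / (9 * x)) * 9 ^ k * k ! := by
    have h := pow_le_exp_div_mul (r := 2 / x) (a := 9) (by positivity) (by norm_num) k
    rwa [div_div, mul_comm x] at h
  calc ‖iteratedDeriv k (fun z : ℂ => Complex.exp (-z⁻¹)) x‖
      ≤ k ! * Real.exp (-(2 / (9 * x))) / (x / 2) ^ k := hcauchy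
    _ = k ! * Real.exp (-(2 / (9 * x))) * (2 / x) ^ k := by
        rw [← inv_div 2 x, inv_pow, div_inv_eq_mul]
    _ ≤ k ! * Real.exp (-(2 / (9 * x))) * (Real.exp (2 / (9 * x)) * 9 ^ k * k !) := by gcongr
    _ = 9 ^ k * (k ! : ℝ) ^ 2 := by
        rw [Real.exp_neg]
        field_simp

theorem norm_iteratedDeriv_expNegInvGlue_le (k : ℕ) {x : ℝ} (hx : x ≠ 0) :
    ‖iteratedDeriv k (fun x : ℝ => (expNegInvGlue x : ℂ)) x‖ ≤ 9 ^ k * (k ! : ℝ) ^ 2 := by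
  rcases hx.lt_or_gt with hneg | hpos
  · have hzero : (fun y : ℝ => (expNegInvGlue y : ℂ)) =ᶠ[𝓝 x] fun _ => 0 := by
      filter_upwards [gt_mem_nhds hneg] with y hy
      rw [expNegInvGlue.zero_of_nonpos hy.le, Complex.ofReal_zero]
    rw [hzero.iteratedDeriv_eq, show iteratedDeriv k (fun _ : ℝ => (0 : ℂ)) x = 0 from
      iteratedDeriv_const_zero, norm_zero]
    positivity
  · have hexp : (fun y : ℝ => (expNegInvGlue y : ℂ)) =ᶠ[𝓝 x]
        fun y : ℝ => Complex.exp (-(y : ℂ)⁻¹) := by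
      filter_upwards [lt_mem_nhds hpos] with y hy
      simp [expNegInvGlue, not_le.mpr hy]
    have hne : (x : ℂ) ≠ 0 := Complex.ofReal_ne_zero.mpr hpos.ne'
    rw [hexp.iteratedDeriv_eq, iteratedDeriv_comp_ofReal (F := fun z => Complex.exp (-z⁻¹)) k
      (analyticAt_inv hne).neg.cexp]
    exact norm_iteratedDeriv_cexp_neg_inv_le k hpos

theorem uniformGevrey_expNegInvGlue : UniformGevrey 2 9 fun x : ℝ => (expNegInvGlue x : ℂ) := by
  have hsmooth : ContDiff ℝ ∞ fun x : ℝ => (expNegInvGlue x : ℂ) :=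
    Complex.ofRealCLM.contDiff.comp expNegInvGlue.contDiff
  refine ⟨hsmooth, 1, zero_le_one, fun k => ?_⟩
  rw [one_mul, Real.rpow_two]
  have hclosed : IsClosed {x : ℝ | ‖iteratedDeriv k (fun x : ℝ => (expNegInvGlue x : ℂ)) x‖ ≤
      9 ^ k * (k ! : ℝ) ^ 2} :=
    isClosed_le (hsmooth.continuous_iteratedDeriv k (by exact_mod_cast le_top)).norm
      continuous_const
  exact (dense_compl_singleton (0 : ℝ)).induction
    (fun x hx => norm_iteratedDeriv_expNegInvGlue_le k hx) hclosed

/-- A smooth bump function, positive on `(-r, r)` and zero elsewhere. It takes values in `ℂ` so that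
its Fourier transform makes sense. -/
noncomputable def gevreyBump (r x : ℝ) : ℂ :=
  (expNegInvGlue (r + x) * expNegInvGlue (r + -x) : ℝ)

theorem uniformGevrey_gevreyBump (r : ℝ) : UniformGevrey 2 18 (gevreyBump r) := by
  have hglue := uniformGevrey_expNegInvGlue.comp_const_add r
  have h := hglue.mul hglue.comp_neg (by norm_num) (by norm_num) (by norm_num)
  norm_num only [← Complex.ofReal_mul] at h
  exact h

theorem support_gevreyBump_subset (r : ℝ) : Function.support (gevreyBump r) ⊆ Icc (-r) r := by
  intro x hx
  simp only [gevreyBump, Function.mem_support, ne_eq, Complex.ofReal_eq_zero, mul_eq_zero,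
    expNegInvGlue.zero_iff_nonpos, not_or, not_le] at hx
  exact ⟨by linarith [hx.1], by linarith [hx.2]⟩

theorem hasCompactSupport_gevreyBump (r : ℝ) : HasCompactSupport (gevreyBump r) :=
  HasCompactSupport.of_support_subset_isCompact isCompact_Icc (support_gevreyBump_subset r)

theorem integral_gevreyBump_ne_zero {r : ℝ} (hr : 0 < r) : ∫ x, gevreyBump r x ≠ 0 := by
  have hcont : Continuous fun x => expNegInvGlue (r + x) * expNegInvGlue (r + -x) := by
    have hglue : Continuous expNegInvGlue := (expNegInvGlue.contDiff (n := 0)).continuous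
    fun_prop
  have hsupp : HasCompactSupport fun x => expNegInvGlue (r + x) * expNegInvGlue (r + -x) :=
    (hasCompactSupport_comp_left Complex.ofReal_eq_zero).mp (hasCompactSupport_gevreyBump r)
  have hpos : 0 < ∫ x, expNegInvGlue (r + x) * expNegInvGlue (r + -x) :=
    hcont.integral_pos_of_hasCompactSupport_nonneg_nonzero hsupp
      (fun x => mul_nonneg (expNegInvGlue.nonneg _) (expNegInvGlue.nonneg _)) (x := 0)
      (by simpa using (expNegInvGlue.pos_of_pos hr).ne')
  simp only [gevreyBump, integral_complex_ofReal]
  exact_mod_cast hpos.ne'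

section Convolution

variable {E F G : Type*} [NormedAddCommGroup E] [NormedSpace ℝ E] [NormedAddCommGroup F]
  [NormedSpace ℝ F] [NormedAddCommGroup G] [NormedSpace ℝ G] (L : E →L[ℝ] F →L[ℝ] G)
  {f : ℝ → E} {g : ℝ → F}

theorem iteratedDeriv_convolution_right (hf : LocallyIntegrable f) (hg : ContDiff ℝ ∞ g)
    (hgc : HasCompactSupport g) (k : ℕ) :
    iteratedDeriv k (f ⋆[L] g) = f ⋆[L] iteratedDeriv k g := by
  induction k generalizing g with
  | zero => simp
  | succ k ih =>
    have hderiv : deriv (f ⋆[L] g) = f ⋆[L] deriv g := funext fun x =>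
      (hgc.hasDerivAt_convolution_right L hf (hg.of_le (by exact_mod_cast le_top)) x).deriv
    rw [iteratedDeriv_succ', iteratedDeriv_succ', hderiv,
      ih (contDiff_infty_iff_deriv.mp hg).2 hgc.deriv]

theorem UniformGevrey.convolution_right {s a : ℝ} (hg : UniformGevrey s a g)
    (hgc : HasCompactSupport g) (hf : Integrable f) : UniformGevrey s a (f ⋆[L] g) := by
  obtain ⟨C, hC, hgC⟩ := hg.exists_bound
  refine ⟨hgc.contDiff_convolution_right L hf.locallyIntegrable hg.contDiff,
    (∫ y, ‖L‖ * ‖f y‖) * C, by positivity, fun k x => ?_⟩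
  rw [iteratedDeriv_convolution_right L hf.locallyIntegrable hg.contDiff hgc, convolution_def,
    mul_assoc, mul_assoc, ← integral_mul_const]
  refine norm_integral_le_of_norm_le ((hf.norm.const_mul _).mul_const _)
    (Eventually.of_forall fun y => ?_)
  refine (L.le_opNorm₂ _ _).trans (mul_le_mul_of_nonneg_left ?_ (by positivity))
  rw [← mul_assoc]
  exact hgC k _

end Convolution

/-- The convolution of `f` with its reflected conjugate. Its Fourier transform is `|𝓕 f| ^ 2`. -/
noncomputable def autocorrelation (f : ℝ → ℂ) : ℝ → ℂ :=
  f ⋆[ContinuousLinearMap.mul ℝ ℂ] fun x => conj (f (-x))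

theorem support_autocorrelation_subset {f : ℝ → ℂ} {r : ℝ}
    (hf : Function.support f ⊆ Icc (-r) r) :
    Function.support (autocorrelation f) ⊆ Icc (-(2 * r)) (2 * r) := by
  refine (support_convolution_subset _).trans ?_
  rintro _ ⟨x, hx, y, hy, rfl⟩
  have hxr := hf hx
  have hyr : -y ∈ Icc (-r) r := hf (by simpa using hy)
  exact ⟨by linarith [hxr.1, hyr.2], by linarith [hxr.2, hyr.1]⟩

theorem UniformGevrey.autocorrelation {s a : ℝ} {f : ℝ → ℂ} (hf : UniformGevrey s a f)
    (hfc : HasCompactSupport f) : UniformGevrey s a (autocorrelation f) :=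
  hf.comp_neg.star.convolution_right _ ((hfc.comp_homeomorph (Homeomorph.neg ℝ)).comp_left
    (map_zero conj)) (hf.contDiff.continuous.integrable_of_hasCompactSupport hfc)

theorem fourier_conj_comp_neg (f : ℝ → ℂ) (ξ : ℝ) :
    𝓕 (fun x => conj (f (-x))) ξ = conj (𝓕 f ξ) := by
  rw [Real.fourier_real_eq_integral_exp_smul, Real.fourier_real_eq_integral_exp_smul,
    ← integral_conj, ← integral_neg_eq_self]
  refine integral_congr_ae (Eventually.of_forall fun x => ?_)
  simp [← Complex.exp_conj, map_ofNat]

theorem fourier_autocorrelation {f : ℝ → ℂ} (hf : Integrable f) (ξ : ℝ) :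
    𝓕 (autocorrelation f) ξ = Complex.normSq (𝓕 f ξ) := by
  have hreflect : Integrable fun x => conj (f (-x)) :=
    Complex.conjCLE.toContinuousLinearMap.integrable_comp hf.comp_neg
  have h := Real.fourier_mul_convolution_eq hf hreflect ξ
  rwa [fourier_conj_comp_neg, Complex.mul_conj] at h

theorem exists_gevreyCutoff {δ : ℝ} (hδ : 0 < δ) :
    ∃ χ : ℝ → ℂ, UniformGevrey 2 18 χ ∧ tsupport χ ⊆ Ioo (-δ) δ ∧
      (∀ ν, 0 ≤ (𝓕 χ ν).re) ∧ 0 < (𝓕 χ 0).re := by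
  have hsmooth := uniformGevrey_gevreyBump (δ / 4)
  have hcompact := hasCompactSupport_gevreyBump (δ / 4)
  have hfourier := fourier_autocorrelation
    (hsmooth.contDiff.continuous.integrable_of_hasCompactSupport hcompact)
  refine ⟨autocorrelation (gevreyBump (δ / 4)), hsmooth.autocorrelation hcompact, ?_,
    fun ν => ?_, ?_⟩
  · refine (closure_minimal (support_autocorrelation_subset (support_gevreyBump_subset (δ / 4)))
      isClosed_Icc).trans (Icc_subset_Ioo ?_ ?_) <;> linarith
  · rw [hfourier, Complex.ofReal_re]
    exact Complex.normSq_nonneg _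
  · rw [hfourier, Complex.ofReal_re, Complex.normSq_pos, Real.fourier_real_eq]
    simpa using integral_gevreyBump_ne_zero (by positivity)

theorem UniformGevrey.tsum {ι E : Type*} [NormedAddCommGroup E] [NormedSpace ℝ E]
    [CompleteSpace E] {s a : ℝ} {f : ι → ℝ → E} {b : ι → ℝ}
    (hf : ∀ j, ContDiff ℝ ∞ (f j)) (hb : Summable b)
    (hfb : ∀ k j x, ‖iteratedDeriv k (f j) x‖ ≤ b j * (a ^ k * (k ! : ℝ) ^ s)) :
    UniformGevrey s a fun x => ∑' j, f j x := by
  have hb0 : ∀ j, 0 ≤ b j := fun j => (norm_nonneg _).trans (by simpa using hfb 0 j 0)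
  have hsum : ∀ k : ℕ, Summable fun j => b j * (a ^ k * (k ! : ℝ) ^ s) := fun k =>
    hb.mul_right _
  have hbound : ∀ (k : ℕ) (j : ι) (x : ℝ),
      ‖iteratedFDeriv ℝ k (f j) x‖ ≤ b j * (a ^ k * (k ! : ℝ) ^ s) := fun k j x => by
    rw [norm_iteratedFDeriv_eq_norm_iteratedDeriv]
    exact hfb k j x
  refine ⟨contDiff_tsum hf (fun k _ => hsum k) fun k j x _ => hbound k j x, ∑' j, b j,
    tsum_nonneg hb0, fun k x => ?_⟩
  rw [← norm_iteratedFDeriv_eq_norm_iteratedDeriv,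
    iteratedFDeriv_tsum_apply hf (fun k _ => hsum k) (fun k j x _ => hbound k j x)
      (by exact_mod_cast le_top), mul_assoc, ← tsum_mul_right]
  exact tsum_of_norm_bounded (hsum k).hasSum fun j => hbound k j x

theorem integral_cexp_mul_eq_fourier (g : ℝ → ℂ) (ξ : ℝ) :
    ∫ x : ℝ, Complex.exp (Complex.I * ξ * x) * g x = 𝓕 g (-ξ / (2 * Real.pi)) := by
  rw [Real.fourier_real_eq_integral_exp_smul]
  refine integral_congr_ae (Eventually.of_forall fun x => ?_)
  simp only [smul_eq_mul]
  congr 2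
  push_cast
  field_simp

theorem fourier_mul_cexp (χ : ℝ → ℂ) (η ν : ℝ) :
    𝓕 (fun x => χ x * Complex.exp (Complex.I * η * x)) ν = 𝓕 χ (ν - η / (2 * Real.pi)) := by
  rw [Real.fourier_real_eq_integral_exp_smul, Real.fourier_real_eq_integral_exp_smul]
  refine integral_congr_ae (Eventually.of_forall fun x => ?_)
  simp only [smul_eq_mul]
  rw [mul_left_comm, ← Complex.exp_add, mul_comm]
  congr 2
  push_cast
  field_simp
  ring

theorem tsupport_iteratedDeriv_subset {E : Type*} [NormedAddCommGroup E] [NormedSpace ℝ E]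
    (k : ℕ) (g : ℝ → E) : tsupport (iteratedDeriv k g) ⊆ tsupport g := by
  induction k with
  | zero => simp
  | succ k ih =>
    rw [iteratedDeriv_succ]
    exact tsupport_deriv_subset.trans ih

theorem integrable_iteratedDeriv {E : Type*} [NormedAddCommGroup E] [NormedSpace ℝ E]
    {g : ℝ → E} (hg : ContDiff ℝ ∞ g) (hgc : HasCompactSupport g) (k : ℕ) :
    Integrable (iteratedDeriv k g) :=
  (hg.continuous_iteratedDeriv k (by exact_mod_cast le_top)).integrable_of_hasCompactSupport
    (hgc.of_isClosed_subset (isClosed_tsupport _) (tsupport_iteratedDeriv_subset k g))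

/-- The iterates `(i ∂_x) ^ k g`. The operator `i ∂_x` is the transpose of `-i ∂_x`, which agrees
with `∂_t ^ 2` on the solutions of `∂_t ^ 2 u + i ∂_x u = 0`. -/
noncomputable def transposeIterate (k : ℕ) (g : ℝ → ℂ) (x : ℝ) : ℂ :=
  Complex.I ^ k * iteratedDeriv k g x

theorem transposeIterate_zero (g : ℝ → ℂ) : transposeIterate 0 g = g := by
  ext x
  simp [transposeIterate]

theorem norm_transposeIterate (k : ℕ) (g : ℝ → ℂ) (x : ℝ) :
    ‖transposeIterate k g x‖ = ‖iteratedDeriv k g x‖ := by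
  simp [transposeIterate]

theorem tsupport_transposeIterate_subset (k : ℕ) (g : ℝ → ℂ) :
    tsupport (transposeIterate k g) ⊆ tsupport g :=
  tsupport_mul_subset_right.trans (tsupport_iteratedDeriv_subset k g)

theorem contDiff_transposeIterate {g : ℝ → ℂ} (hg : ContDiff ℝ ∞ g) (k : ℕ) :
    ContDiff ℝ ∞ (transposeIterate k g) := by
  refine contDiff_const.mul ?_
  rw [iteratedDeriv_eq_iterate]
  exact hg.iterate_deriv k

theorem deriv_transposeIterate {g : ℝ → ℂ} (hg : ContDiff ℝ ∞ g) (k : ℕ) (x : ℝ) :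
    Complex.I * deriv (transposeIterate k g) x = transposeIterate (k + 1) g x := by
  have hdiff := hg.differentiable_iteratedDeriv k (by exact_mod_cast ENat.natCast_lt_top k)
  unfold transposeIterate
  rw [deriv_const_mul _ (hdiff x), iteratedDeriv_succ, pow_succ']
  ring

theorem integral_cexp_mul_transposeIterate {g : ℝ → ℂ} (hg : ContDiff ℝ ∞ g)
    (hgc : HasCompactSupport g) (k : ℕ) (ξ : ℝ) :
    ∫ x : ℝ, Complex.exp (Complex.I * ξ * x) * transposeIterate k g x =
      ξ ^ k * 𝓕 g (-ξ / (2 * Real.pi)) := by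
  have hfourier := congrFun (Real.fourier_iteratedDeriv hg
    (fun n _ => integrable_iteratedDeriv hg hgc n) (n := k) le_top) (-ξ / (2 * Real.pi))
  simp only [transposeIterate, mul_left_comm _ (Complex.I ^ k), integral_const_mul]
  rw [integral_cexp_mul_eq_fourier, hfourier, smul_eq_mul, ← mul_assoc, ← mul_pow]
  congr 2
  push_cast
  field_simp
  simp

/-- The superposition of the plane waves with frequencies `ξ j` and amplitudes `c j`. -/
noncomputable def expSum {ι : Type*} (c ξ : ι → ℝ) (x : ℝ) : ℂ :=
  ∑' j, c j * Complex.exp (Complex.I * ξ j * x)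

section ExpSum

variable {ι : Type*} [Countable ι] {c ξ : ι → ℝ}

theorem hasSum_integral_expSum_mul (hc : Summable c) {h : ℝ → ℂ} (hh : Integrable h) :
    HasSum (fun j => c j * ∫ x : ℝ, Complex.exp (Complex.I * ξ j * x) * h x)
      (∫ x, expSum c ξ x * h x) := by
  have hnorm : ∀ j (x : ℝ), ‖c j * (Complex.exp (Complex.I * ξ j * x) * h x)‖ = |c j| * ‖h x‖ :=
    fun j x => by
      rw [norm_mul, norm_mul, norm_cexp_I_mul_ofReal_mul, one_mul, Complex.norm_real,
        Real.norm_eq_abs]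
  have hint : ∀ j, Integrable fun x : ℝ => c j * (Complex.exp (Complex.I * ξ j * x) * h x) :=
    fun j => (hh.bdd_mul (contDiff_cexp_I_mul (ξ j)).continuous.aestronglyMeasurable
      (Eventually.of_forall fun x => (norm_cexp_I_mul_ofReal_mul (ξ j) x).le)).const_mul _
  have hsum := hasSum_integral_of_summable_integral_norm hint (by
    simp only [hnorm, integral_const_mul]
    exact hc.abs.mul_right _)
  simp only [integral_const_mul] at hsum
  simpa only [expSum, ← tsum_mul_right, mul_assoc] using hsum

theorem hasSum_integral_expSum_mul_transposeIterate (hc : Summable c) {g : ℝ → ℂ}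
    (hg : ContDiff ℝ ∞ g) (hgc : HasCompactSupport g) (k : ℕ) :
    HasSum (fun j => (c j * ξ j ^ k : ℝ) * 𝓕 g (-ξ j / (2 * Real.pi)))
      (∫ x, expSum c ξ x * transposeIterate k g x) := by
  have hsum : HasSum _ (∫ x, expSum c ξ x * transposeIterate k g x) :=
    hasSum_integral_expSum_mul hc ((integrable_iteratedDeriv hg hgc k).const_mul (Complex.I ^ k))
  have hterm := fun j => integral_cexp_mul_transposeIterate hg hgc k (ξ j)
  simp only [transposeIterate] at hterm hsum ⊢
  simp only [hterm] at hsum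
  simpa only [mul_assoc, Complex.ofReal_mul, Complex.ofReal_pow] using hsum

theorem le_re_integral_expSum_mul_transposeIterate (hc : Summable c) (hc0 : ∀ j, 0 ≤ c j)
    (hξ : ∀ j, 0 ≤ ξ j) {χ : ℝ → ℂ} (hχ : ContDiff ℝ ∞ χ) (hχc : HasCompactSupport χ)
    (hpos : ∀ ν, 0 ≤ (𝓕 χ ν).re) (k : ℕ) (m : ι) :
    c m * ξ m ^ k * (𝓕 χ 0).re ≤ (∫ x, expSum c ξ x * transposeIterate k
      (fun y => χ y * Complex.exp (Complex.I * (-ξ m : ℝ) * y)) x).re := by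
  have hsum := Complex.hasSum_re (hasSum_integral_expSum_mul_transposeIterate (ξ := ξ) hc
    (hχ.mul (contDiff_cexp_I_mul (-ξ m))) hχc.mul_right k)
  simp only [Complex.re_ofReal_mul, fourier_mul_cexp] at hsum
  have hterm := le_hasSum hsum m fun j _ =>
    mul_nonneg (mul_nonneg (hc0 j) (pow_nonneg (hξ j) k)) (hpos _)
  rwa [sub_self] at hterm

end ExpSum

theorem exp_neg_mul_rpow_pow_le {s : ℝ} (hs : 0 < s) (k j : ℕ) :
    Real.exp (-j) * ((j : ℝ) ^ s) ^ k ≤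
      Real.exp (-(j / 2)) * (((2 * s) ^ s) ^ k * (k ! : ℝ) ^ s) := by
  have hpow : ((j : ℝ) ^ k) ^ s ≤ (Real.exp (j / (2 * s)) * (2 * s) ^ k * k !) ^ s :=
    Real.rpow_le_rpow (by positivity)
      (pow_le_exp_div_mul (Nat.cast_nonneg j) (by positivity) k) hs.le
  have hexp : Real.exp (j / (2 * s)) ^ s = Real.exp (j / 2) := by
    rw [← Real.exp_mul]
    congr 1
    field_simp
  rw [Real.mul_rpow (by positivity) (by positivity), Real.mul_rpow (by positivity) (by positivity),
    hexp] at hpow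
  calc Real.exp (-j) * ((j : ℝ) ^ s) ^ k
      = Real.exp (-j) * ((j : ℝ) ^ k) ^ s := by rw [Real.rpow_pow_comm (by positivity)]
    _ ≤ Real.exp (-j) * (Real.exp (j / 2) * ((2 * s) ^ k) ^ s * (k ! : ℝ) ^ s) := by gcongr
    _ = (Real.exp (-j) * Real.exp (j / 2)) * (((2 * s) ^ k) ^ s * (k ! : ℝ) ^ s) := by ring
    _ = Real.exp (-(j / 2)) * (((2 * s) ^ s) ^ k * (k ! : ℝ) ^ s) := by
        rw [← Real.exp_add, Real.rpow_pow_comm (by positivity)]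
        congr 2
        ring

theorem uniformGevrey_expSum {s : ℝ} (hs : 0 < s) :
    UniformGevrey s ((2 * s) ^ s) (expSum (fun j : ℕ => Real.exp (-j)) fun j => (j : ℝ) ^ s) := by
  have hsum : Summable fun j : ℕ => Real.exp (-(j / 2 : ℝ)) := by
    simpa [div_eq_mul_inv, mul_comm] using
      Real.summable_exp_nat_mul_iff.mpr (by norm_num : -(1 / 2 : ℝ) < 0)
  refine UniformGevrey.tsum (fun j => contDiff_const.mul (contDiff_cexp_I_mul _)) hsum
    fun k j x => ?_
  rw [iteratedDeriv_const_mul_field, norm_mul, norm_iteratedDeriv_cexp_I_mul, Complex.norm_real,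
    Real.norm_of_nonneg (Real.exp_pos _).le, abs_of_nonneg (by positivity)]
  exact exp_neg_mul_rpow_pow_le hs k j

theorem hasDerivWithinAt_intervalIntegral {E : Type*} [NormedAddCommGroup E] [NormedSpace ℝ E]
    {s : Set ℝ} (hs : Convex ℝ s) (hsc : IsCompact s) {a b : ℝ} {f f' : ℝ × ℝ → E}
    (hf : ContinuousOn f (s ×ˢ uIcc a b)) (hf' : ContinuousOn f' (s ×ˢ uIcc a b))
    (hderiv : ∀ t ∈ s, ∀ x ∈ uIcc a b, HasDerivWithinAt (fun τ => f (τ, x)) (f' (t, x)) s t)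
    {t : ℝ} (ht : t ∈ s) :
    HasDerivWithinAt (fun τ => ∫ x in a..b, f (τ, x)) (∫ x in a..b, f' (t, x)) s t := by
  obtain ⟨B, hB⟩ := (hsc.prod isCompact_uIcc).exists_bound_of_continuousOn hf'
  have hslice : ∀ τ ∈ s, ContinuousOn (fun x => f (τ, x)) (uIcc a b) := fun τ hτ =>
    hf.comp (by fun_prop) fun _ hx => ⟨hτ, hx⟩
  have hmem : ∀ᶠ τ in 𝓝[s \ {t}] t, τ ∈ s \ {t} := self_mem_nhdsWithin
  rw [hasDerivWithinAt_iff_tendsto_slope]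
  have hlim : Tendsto (fun τ => ∫ x in a..b, slope (fun σ => f (σ, x)) t τ) (𝓝[s \ {t}] t)
      (𝓝 (∫ x in a..b, f' (t, x))) := by
    refine intervalIntegral.tendsto_integral_filter_of_dominated_convergence (fun _ => B) ?_ ?_
      intervalIntegrable_const ?_
    · filter_upwards [hmem] with τ hτ
      simp only [slope_def_module]
      exact ((((hslice τ hτ.1).sub (hslice t ht)).const_smul _).mono
        uIoc_subset_uIcc).aestronglyMeasurable measurableSet_uIoc
    · filter_upwards [hmem] with τ hτ
      refine Eventually.of_forall fun x hx => ?_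
      have hlip := hs.norm_image_sub_le_of_norm_hasDerivWithin_le
        (fun σ hσ => hderiv σ hσ x (uIoc_subset_uIcc hx))
        (fun σ hσ => hB (σ, x) ⟨hσ, uIoc_subset_uIcc hx⟩) ht hτ.1
      have hne : 0 < ‖τ - t‖ := norm_pos_iff.mpr (sub_ne_zero.mpr hτ.2)
      rwa [slope_def_module, norm_smul, norm_inv, inv_mul_le_iff₀ hne, mul_comm]
    · exact Eventually.of_forall fun x hx =>
        hasDerivWithinAt_iff_tendsto_slope.mp (hderiv t ht x (uIoc_subset_uIcc hx))
  refine hlim.congr' ?_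
  filter_upwards [hmem] with τ hτ
  simp only [slope_def_module]
  rw [intervalIntegral.integral_smul, intervalIntegral.integral_sub
    (hslice τ hτ.1).intervalIntegrable (hslice t ht).intervalIntegrable]

section Taylor

variable {E : Type*} [NormedAddCommGroup E] [NormedSpace ℝ E] {T K : ℝ}

theorem hasDerivAt_pow_succ_div_factorial (n : ℕ) (t : ℝ) :
    HasDerivAt (fun τ : ℝ => τ ^ (n + 1) / (n + 1)!) (t ^ n / n !) t := by
  refine ((hasDerivAt_pow (n + 1) t).div_const ((n + 1)! : ℝ)).congr_deriv ?_
  rw [Nat.factorial_succ, Nat.add_sub_cancel]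
  push_cast
  field_simp

theorem norm_le_pow_succ_div_factorial {f f' : ℝ → E} {n : ℕ} (hf0 : f 0 = 0)
    (hf : ∀ t ∈ Icc 0 T, HasDerivWithinAt f (f' t) (Icc 0 T) t)
    (hf' : ∀ t ∈ Icc 0 T, ‖f' t‖ ≤ K * (t ^ n / n !)) :
    ∀ t ∈ Icc 0 T, ‖f t‖ ≤ K * (t ^ (n + 1) / (n + 1)!) := by
  exact image_norm_le_of_norm_deriv_right_le_deriv_boundary
    (fun t ht => (hf t ht).continuousWithinAt)
    (fun t ht => (hf t (Ico_subset_Icc_self ht)).mono_of_mem_nhdsWithin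
      (Icc_mem_nhdsGE_of_mem ht)) (by simp [hf0])
    (fun t => (hasDerivAt_pow_succ_div_factorial n t).const_mul K)
    (fun t ht => hf' t (Ico_subset_Icc_self ht))

theorem norm_sub_sum_pow_two_mul_smul_le {M V : ℕ → ℝ → E}
    (hM : ∀ k, ∀ t ∈ Icc 0 T, HasDerivWithinAt (M k) (V k t) (Icc 0 T) t)
    (hV : ∀ k, ∀ t ∈ Icc 0 T, HasDerivWithinAt (V k) (M (k + 1) t) (Icc 0 T) t)
    (hV0 : ∀ k, V k 0 = 0) (n : ℕ) (hK : ∀ t ∈ Icc 0 T, ‖M n t‖ ≤ K) :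
    ∀ t ∈ Icc 0 T, ‖M 0 t - ∑ k ∈ Finset.range n, (t ^ (2 * k) / (2 * k)!) • M k 0‖ ≤
      K * (t ^ (2 * n) / (2 * n)!) := by
  induction n generalizing M V with
  | zero => simpa using hK
  | succ n ih =>
    have hsecond := ih (fun k => hM (k + 1)) (fun k => hV (k + 1)) (fun k => hV0 (k + 1)) hK
    have hfirst := norm_le_pow_succ_div_factorial
      (f := fun t => V 0 t -
        ∑ k ∈ Finset.range n, (t ^ (2 * k + 1) / (2 * k + 1)!) • M (k + 1) 0)
      (by simp [hV0]) (fun t ht => (hV 0 t ht).sub (HasDerivWithinAt.fun_sum fun k _ =>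
        ((hasDerivAt_pow_succ_div_factorial _ t).smul_const _).hasDerivWithinAt)) hsecond
    have hzeroth := norm_le_pow_succ_div_factorial
      (f := fun t => M 0 t - M 0 0 -
        ∑ k ∈ Finset.range n, (t ^ (2 * k + 1 + 1) / (2 * k + 1 + 1)!) • M (k + 1) 0)
      (by simp) (fun t ht => ((hM 0 t ht).sub_const _).sub (HasDerivWithinAt.fun_sum fun k _ =>
        ((hasDerivAt_pow_succ_div_factorial _ t).smul_const _).hasDerivWithinAt)) hfirst
    intro t ht
    rw [Finset.sum_range_succ', sub_add_eq_sub_sub_swap]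
    simpa [Nat.mul_succ] using hzeroth t ht

end Taylor

/-- The partial derivative `∂_t f` of `f = f (t, x)` relative to `S`, one-sided at the boundary
points of `S`. -/
noncomputable def timeDerivWithin (S : Set (ℝ × ℝ)) (f : ℝ × ℝ → ℂ) (p : ℝ × ℝ) : ℂ :=
  fderivWithin ℝ f S p (1, 0)

/-- The partial derivative `∂_x f` of `f = f (t, x)` relative to `S`, one-sided at the boundary
points of `S`. -/
noncomputable def spaceDerivWithin (S : Set (ℝ × ℝ)) (f : ℝ × ℝ → ℂ) (p : ℝ × ℝ) : ℂ :=
  fderivWithin ℝ f S p (0, 1)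

section Slices

variable {S : Set (ℝ × ℝ)} {f : ℝ × ℝ → ℂ}

theorem contDiffOn_timeDerivWithin (hf : ContDiffOn ℝ ∞ f S) (hS : UniqueDiffOn ℝ S) :
    ContDiffOn ℝ ∞ (timeDerivWithin S f) S :=
  (hf.fderivWithin hS (by simp)).clm_apply contDiffOn_const

theorem contDiffOn_spaceDerivWithin (hf : ContDiffOn ℝ ∞ f S) (hS : UniqueDiffOn ℝ S) :
    ContDiffOn ℝ ∞ (spaceDerivWithin S f) S :=
  (hf.fderivWithin hS (by simp)).clm_apply contDiffOn_const

theorem hasDerivWithinAt_timeDerivWithin (hf : ContDiffOn ℝ ∞ f S) {I : Set ℝ} {t x : ℝ}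
    (hI : ∀ τ ∈ I, (τ, x) ∈ S) (ht : t ∈ I) :
    HasDerivWithinAt (fun τ => f (τ, x)) (timeDerivWithin S f (t, x)) I t :=
  (hf.differentiableOn (by simp) _ (hI t ht)).hasFDerivWithinAt.comp_hasDerivWithinAt t
    ((hasDerivWithinAt_id t I).prodMk (hasDerivWithinAt_const t I x)) hI

theorem hasDerivWithinAt_spaceDerivWithin (hf : ContDiffOn ℝ ∞ f S) {J : Set ℝ} {t x : ℝ}
    (hJ : ∀ y ∈ J, (t, y) ∈ S) (hx : x ∈ J) :
    HasDerivWithinAt (fun y => f (t, y)) (spaceDerivWithin S f (t, x)) J x :=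
  (hf.differentiableOn (by simp) _ (hJ x hx)).hasFDerivWithinAt.comp_hasDerivWithinAt x
    ((hasDerivWithinAt_const x J t).prodMk (hasDerivWithinAt_id x J)) hJ

theorem deriv_eq_timeDerivWithin (hS : IsOpen S) (hf : ContDiffOn ℝ ∞ f S) {t x : ℝ}
    (hp : (t, x) ∈ S) : deriv (fun τ => f (τ, x)) t = timeDerivWithin S f (t, x) :=
  ((hasDerivWithinAt_timeDerivWithin (I := {τ | (τ, x) ∈ S}) hf (fun _ h => h) hp).hasDerivAt
    ((hS.preimage (by fun_prop)).mem_nhds hp)).deriv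

theorem deriv_eq_spaceDerivWithin (hf : ContDiffOn ℝ ∞ f S) {t x : ℝ}
    (hp : ∀ᶠ y in 𝓝 x, (t, y) ∈ S) : deriv (fun y => f (t, y)) x = spaceDerivWithin S f (t, x) :=
  ((hasDerivWithinAt_spaceDerivWithin (J := {y | (t, y) ∈ S}) hf (fun _ h => h)
    hp.self_of_nhds).hasDerivAt hp).deriv

theorem hasDerivWithinAt_intervalIntegral_mul (hf : ContDiffOn ℝ ∞ f S) (hS : UniqueDiffOn ℝ S)
    {T a b : ℝ} (hsub : Icc 0 T ×ˢ uIcc a b ⊆ S) {ψ : ℝ → ℂ} (hψ : Continuous ψ) {t : ℝ}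
    (ht : t ∈ Icc 0 T) :
    HasDerivWithinAt (fun τ => ∫ x in a..b, f (τ, x) * ψ x)
      (∫ x in a..b, timeDerivWithin S f (t, x) * ψ x) (Icc 0 T) t := by
  have hcont : ∀ {F : ℝ × ℝ → ℂ}, ContDiffOn ℝ ∞ F S →
      ContinuousOn (fun p => F p * ψ p.2) (Icc 0 T ×ˢ uIcc a b) := fun hF =>
    (hF.continuousOn.mono hsub).mul (hψ.comp continuous_snd).continuousOn
  exact hasDerivWithinAt_intervalIntegral (convex_Icc 0 T) isCompact_Icc (hcont hf)
    (hcont (contDiffOn_timeDerivWithin hf hS)) (fun τ hτ x hx =>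
      (hasDerivWithinAt_timeDerivWithin hf (fun σ hσ => hsub ⟨hσ, hx⟩) hτ).mul_const (ψ x)) ht

end Slices

/-- `u` is a smooth solution on `S` of the Cauchy problem `∂_t ^ 2 u + i ∂_x u = 0`,
`u (0, x) = φ₀ x`, `∂_t u (0, x) = φ₁ x`. The derivatives are taken relative to `S`, so that open
sets and closed strips are treated alike. -/
structure IsCauchySolutionOn (S : Set (ℝ × ℝ)) (φ₀ φ₁ : ℝ → ℂ) (u : ℝ × ℝ → ℂ) : Prop where
  contDiffOn : ContDiffOn ℝ ∞ u S
  equation : ∀ p ∈ S,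
    timeDerivWithin S (timeDerivWithin S u) p + Complex.I * spaceDerivWithin S u p = 0
  initial_value : ∀ x, (0, x) ∈ S → u (0, x) = φ₀ x
  initial_velocity : ∀ x, (0, x) ∈ S → timeDerivWithin S u (0, x) = φ₁ x

theorem LocallySolvableAtOrigin.exists_isCauchySolutionOn {A : Set (ℝ → ℂ)}
    (h : LocallySolvableAtOrigin modelOperator A) {φ₀ φ₁ : ℝ → ℂ} (hφ₀ : φ₀ ∈ A) (hφ₁ : φ₁ ∈ A) :
    ∃ U : Set (ℝ × ℝ), IsOpen U ∧ (0, 0) ∈ U ∧ ∃ u, IsCauchySolutionOn U φ₀ φ₁ u := by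
  obtain ⟨U, hU, hU0, u, hu, heq, hdata⟩ := h φ₀ hφ₀ φ₁ hφ₁
  refine ⟨U, hU, hU0, u, hu, fun ⟨t, x⟩ hp => ?_, fun x hx => (hdata x hx).1,
    fun x hx => (deriv_eq_timeDerivWithin hU hu hx).symm.trans (hdata x hx).2⟩
  have hsecond : iteratedDeriv 2 (fun τ => u (τ, x)) t =
      timeDerivWithin U (timeDerivWithin U u) (t, x) := by
    have hfirst : deriv (fun τ => u (τ, x)) =ᶠ[𝓝 t] fun τ => timeDerivWithin U u (τ, x) := by
      filter_upwards [(hU.preimage (by fun_prop : Continuous fun τ : ℝ => (τ, x))).mem_nhds hp]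
        with τ hτ using deriv_eq_timeDerivWithin hU hu hτ
    rw [iteratedDeriv_succ, iteratedDeriv_one, hfirst.deriv_eq,
      deriv_eq_timeDerivWithin hU (contDiffOn_timeDerivWithin hu hU.uniqueDiffOn) hp]
  rw [← hsecond, ← deriv_eq_spaceDerivWithin hu ((hU.preimage (by fun_prop)).mem_nhds hp)]
  exact heq (t, x) hp

theorem SmoothlySolvableOnStrip.exists_isCauchySolutionOn {T : ℝ} (hT : 0 < T)
    (h : SmoothlySolvableOnStrip T) {φ₀ φ₁ : ℝ → ℂ} (hφ₀ : φ₀ ∈ smoothClass)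
    (hφ₁ : φ₁ ∈ smoothClass) : ∃ u, IsCauchySolutionOn (Icc 0 T ×ˢ univ) φ₀ φ₁ u := by
  obtain ⟨u, hu, heq, hdata⟩ := h φ₀ hφ₀ φ₁ hφ₁
  have hI : UniqueDiffOn ℝ (Icc 0 T) := uniqueDiffOn_Icc hT
  have htime : ∀ {f : ℝ × ℝ → ℂ}, ContDiffOn ℝ ∞ f (Icc 0 T ×ˢ univ) → ∀ x, ∀ t ∈ Icc 0 T,
      derivWithin (fun τ => f (τ, x)) (Icc 0 T) t = timeDerivWithin (Icc 0 T ×ˢ univ) f (t, x) :=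
    fun hf x t ht => (hasDerivWithinAt_timeDerivWithin hf (fun τ hτ => ⟨hτ, mem_univ x⟩)
      ht).derivWithin (hI t ht)
  refine ⟨u, hu, fun ⟨t, x⟩ ⟨ht, _⟩ => ?_, fun x _ => (hdata x).1,
    fun x _ => (htime hu x 0 (left_mem_Icc.mpr hT.le)).symm.trans (hdata x).2⟩
  have hsecond : iteratedDerivWithin 2 (fun τ => u (τ, x)) (Icc 0 T) t =
      timeDerivWithin (Icc 0 T ×ˢ univ) (timeDerivWithin (Icc 0 T ×ˢ univ) u) (t, x) := by
    rw [iteratedDerivWithin_succ, iteratedDerivWithin_one,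
      derivWithin_congr (htime hu x) (htime hu x t ht),
      htime (contDiffOn_timeDerivWithin hu (hI.prod uniqueDiffOn_univ)) x t ht]
  rw [← hsecond, ← deriv_eq_spaceDerivWithin hu (Eventually.of_forall fun y => ⟨ht, mem_univ y⟩)]
  exact heq t ht x

namespace IsCauchySolutionOn

variable {S : Set (ℝ × ℝ)} {φ₀ φ₁ : ℝ → ℂ} {u : ℝ × ℝ → ℂ} {T a b : ℝ}

theorem integral_timeDerivWithin_timeDerivWithin_mul (h : IsCauchySolutionOn S φ₀ φ₁ u)
    (hS : UniqueDiffOn ℝ S) {t : ℝ} (ht : ∀ x ∈ uIcc a b, (t, x) ∈ S) {ψ : ℝ → ℂ}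
    (hψ : ContDiff ℝ 1 ψ) (ha : ψ a = 0) (hb : ψ b = 0) :
    ∫ x in a..b, timeDerivWithin S (timeDerivWithin S u) (t, x) * ψ x =
      ∫ x in a..b, u (t, x) * (Complex.I * deriv ψ x) := by
  have hparts := intervalIntegral.integral_mul_deriv_eq_deriv_mul_of_hasDerivWithinAt
    (fun x hx => hasDerivWithinAt_spaceDerivWithin h.contDiffOn ht hx)
    (fun x _ => (hψ.differentiable one_ne_zero x).hasDerivAt.hasDerivWithinAt)
    ((contDiffOn_spaceDerivWithin h.contDiffOn hS).continuousOn.comp (by fun_prop)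
      ht).intervalIntegrable
    ((hψ.continuous_deriv le_rfl).intervalIntegrable a b)
  rw [ha, hb, mul_zero, mul_zero, sub_zero, zero_sub] at hparts
  have hequation : ∀ x ∈ uIcc a b, timeDerivWithin S (timeDerivWithin S u) (t, x) * ψ x =
      -Complex.I * (spaceDerivWithin S u (t, x) * ψ x) := fun x hx => by
    rw [eq_neg_of_add_eq_zero_left (h.equation _ (ht x hx))]
    ring
  rw [intervalIntegral.integral_congr hequation]
  simp only [mul_left_comm _ Complex.I, intervalIntegral.integral_const_mul]
  rw [hparts, neg_mul_comm]

theorem norm_sub_sum_integral_mul_transposeIterate_le (h : IsCauchySolutionOn S φ₀ 0 u)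
    (hS : UniqueDiffOn ℝ S) (hT : 0 ≤ T) (hsub : Icc 0 T ×ˢ uIcc a b ⊆ S) {g : ℝ → ℂ}
    (hg : ContDiff ℝ ∞ g) (hgs : tsupport g ⊆ Ioo a b) (n : ℕ) {K : ℝ}
    (hK : ∀ t ∈ Icc 0 T, ‖∫ x in a..b, u (t, x) * transposeIterate n g x‖ ≤ K) :
    ‖(∫ x in a..b, u (T, x) * g x) - ∑ k ∈ Finset.range n,
      (T ^ (2 * k) / (2 * k)!) • ∫ x, φ₀ x * transposeIterate k g x‖ ≤
      K * (T ^ (2 * n) / (2 * n)!) := by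
  have hzero : ∀ k x, x ∉ Ioo a b → transposeIterate k g x = 0 := fun k x hx =>
    image_eq_zero_of_notMem_tsupport fun hx' => hx (hgs (tsupport_transposeIterate_subset k g hx'))
  have hinitial : ∀ k, ∫ x in a..b, u (0, x) * transposeIterate k g x =
      ∫ x, φ₀ x * transposeIterate k g x := fun k => by
    rw [← intervalIntegral.integral_eq_integral_of_support_subset (a := a) (b := b)]
    · refine intervalIntegral.integral_congr fun x hx => ?_
      simp only [h.initial_value x (hsub ⟨left_mem_Icc.mpr hT, hx⟩)]
    · exact fun x hx => Ioo_subset_Ioc_self (not_imp_comm.mp (hzero k x) (right_ne_zero_of_mul hx))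
  have htaylor := norm_sub_sum_pow_two_mul_smul_le
    (M := fun k t => ∫ x in a..b, u (t, x) * transposeIterate k g x)
    (V := fun k t => ∫ x in a..b, timeDerivWithin S u (t, x) * transposeIterate k g x)
    (fun k t ht => hasDerivWithinAt_intervalIntegral_mul h.contDiffOn hS hsub
      (contDiff_transposeIterate hg k).continuous ht)
    (fun k t ht => ?_) (fun k => ?_) n hK T (right_mem_Icc.mpr hT)
  · simpa only [hinitial, transposeIterate_zero] using htaylor
  · refine (hasDerivWithinAt_intervalIntegral_mul (contDiffOn_timeDerivWithin h.contDiffOn hS)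
      hS hsub (contDiff_transposeIterate hg k).continuous ht).congr_deriv ?_
    rw [h.integral_timeDerivWithin_timeDerivWithin_mul hS (fun x hx => hsub ⟨ht, hx⟩)
      ((contDiff_transposeIterate hg k).of_le (by simp)) (hzero k a (by simp))
      (hzero k b (by simp))]
    simp only [deriv_transposeIterate hg]
  · refine intervalIntegral.integral_zero_ae (Eventually.of_forall fun x hx => ?_)
    rw [h.initial_velocity x (hsub ⟨left_mem_Icc.mpr hT, uIoc_subset_uIcc hx⟩), Pi.zero_apply,
      zero_mul]

theorem tendsto_sum_integral_mul_transposeIterate (h : IsCauchySolutionOn S φ₀ 0 u)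
    (hS : UniqueDiffOn ℝ S) (hT : 0 ≤ T) (hsub : Icc 0 T ×ˢ uIcc a b ⊆ S) {g : ℝ → ℂ} {r : ℝ}
    (hg : UniformGevrey 2 r g) (hr : 0 ≤ r) (hrT : r * T ^ 2 < 1) (hgs : tsupport g ⊆ Ioo a b) :
    Tendsto (fun n => ∑ k ∈ Finset.range n,
      (T ^ (2 * k) / (2 * k)!) • ∫ x, φ₀ x * transposeIterate k g x) atTop
      (𝓝 (∫ x in a..b, u (T, x) * g x)) := by
  obtain ⟨C, hC0, hC⟩ := hg.exists_bound
  obtain ⟨B, hB⟩ := (isCompact_Icc.prod isCompact_uIcc).exists_bound_of_continuousOn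
    (h.contDiffOn.continuousOn.mono hsub)
  have hB0 : 0 ≤ B := (norm_nonneg _).trans (hB (0, a) ⟨left_mem_Icc.mpr hT, left_mem_uIcc⟩)
  have hK : ∀ n, ∀ t ∈ Icc 0 T, ‖∫ x in a..b, u (t, x) * transposeIterate n g x‖ ≤
      B * (C * r ^ n * (n ! : ℝ) ^ 2) * |b - a| := fun n t ht =>
    intervalIntegral.norm_integral_le_of_norm_le_const fun x hx => by
      rw [norm_mul, norm_transposeIterate]
      exact mul_le_mul (hB (t, x) ⟨ht, uIoc_subset_uIcc hx⟩) (mod_cast hC n x) (norm_nonneg _) hB0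
  have hlim : Tendsto (fun n => B * C * |b - a| * (r * T ^ 2) ^ n) atTop (𝓝 0) := by
    simpa using (tendsto_pow_atTop_nhds_zero_of_lt_one (by positivity) hrT).const_mul
      (B * C * |b - a|)
  rw [tendsto_iff_norm_sub_tendsto_zero]
  refine squeeze_zero (fun _ => norm_nonneg _) (fun n => ?_) hlim
  have hfactorial : (n ! : ℝ) ^ 2 / (2 * n)! ≤ 1 := by
    rw [div_le_one (by positivity), sq, two_mul]
    exact_mod_cast Nat.le_of_dvd (Nat.factorial_pos _)
      (Nat.factorial_mul_factorial_dvd_factorial_add n n)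
  rw [norm_sub_rev]
  calc _ ≤ B * (C * r ^ n * (n ! : ℝ) ^ 2) * |b - a| * (T ^ (2 * n) / (2 * n)!) :=
        h.norm_sub_sum_integral_mul_transposeIterate_le hS hT hsub hg.contDiff hgs n (hK n)
    _ = B * C * |b - a| * (r * T ^ 2) ^ n * ((n ! : ℝ) ^ 2 / (2 * n)!) := by
        rw [mul_pow, ← pow_mul]
        ring
    _ ≤ _ := mul_le_of_le_one_right (by positivity) hfactorial

theorem mul_cosh_mul_re_fourier_le {ι : Type*} [Countable ι] {c ξ : ι → ℝ}
    (h : IsCauchySolutionOn S (expSum c ξ) 0 u) (hS : UniqueDiffOn ℝ S) (hT : 0 ≤ T)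
    (hsub : Icc 0 T ×ˢ uIcc a b ⊆ S) (hc : Summable c) (hc0 : ∀ j, 0 ≤ c j) (hξ : ∀ j, 0 ≤ ξ j)
    {χ : ℝ → ℂ} {r : ℝ} (hχ : UniformGevrey 2 r χ) (hr : 0 ≤ r) (hrT : (r + 1) * T ^ 2 < 1)
    (hχs : tsupport χ ⊆ Ioo a b) (hpos : ∀ ν, 0 ≤ (𝓕 χ ν).re) (m : ι) :
    c m * Real.cosh (T * √(ξ m)) * (𝓕 χ 0).re ≤ |∫ x in a..b, ‖u (T, x) * χ x‖| := by
  set g : ℝ → ℂ := fun x => χ x * Complex.exp (Complex.I * (-ξ m : ℝ) * x) with hgdef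
  have hg : UniformGevrey 2 (r + 1) g :=
    hχ.mul (uniformGevrey_cexp_I_mul one_le_two one_pos (-ξ m)) zero_le_two hr zero_le_one
  have hχc : HasCompactSupport χ :=
    isCompact_Icc.of_isClosed_subset (isClosed_tsupport χ) (hχs.trans Ioo_subset_Icc_self)
  have htaylor := (Complex.continuous_re.tendsto _).comp
    (h.tendsto_sum_integral_mul_transposeIterate hS hT hsub hg (by positivity) hrT
      (tsupport_mul_subset_left.trans hχs))
  have hcosh := ((Real.hasSum_cosh (T * √(ξ m))).mul_right (c m * (𝓕 χ 0).re)).tendsto_sum_nat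
  have hle := le_of_tendsto_of_tendsto' hcosh htaylor fun n => by
    rw [Function.comp_apply, Complex.re_sum]
    refine Finset.sum_le_sum fun k _ => ?_
    rw [Complex.smul_re, smul_eq_mul, mul_pow, pow_mul √(ξ m), Real.sq_sqrt (hξ m)]
    calc _ = T ^ (2 * k) / (2 * k)! * (c m * ξ m ^ k * (𝓕 χ 0).re) := by ring
      _ ≤ _ := mul_le_mul_of_nonneg_left (le_re_integral_expSum_mul_transposeIterate hc hc0 hξ
        hχ.contDiff hχc hpos k m) (by positivity)
  have hnorm : ∀ x, ‖u (T, x) * g x‖ = ‖u (T, x) * χ x‖ := fun x => by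
    rw [hgdef, norm_mul, norm_mul, norm_cexp_I_mul_ofReal_mul, mul_one, norm_mul]
  calc _ = Real.cosh (T * √(ξ m)) * (c m * (𝓕 χ 0).re) := by ring
    _ ≤ ‖∫ x in a..b, u (T, x) * g x‖ := hle.trans (Complex.re_le_norm _)
    _ ≤ |∫ x in a..b, ‖u (T, x) * χ x‖| := by
        simpa only [hnorm] using intervalIntegral.norm_integral_le_abs_integral_norm
          (f := fun x => u (T, x) * g x)

end IsCauchySolutionOn

theorem tendsto_exp_neg_mul_cosh_sqrt {s T : ℝ} (hs : 2 < s) (hT : 0 < T) :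
    Tendsto (fun m : ℕ => Real.exp (-m) * Real.cosh (T * √((m : ℝ) ^ s))) atTop atTop := by
  have hexponent : Tendsto (fun m : ℕ => (m : ℝ) * (T * (m : ℝ) ^ (s / 2 - 1) + -1)) atTop atTop :=
    tendsto_natCast_atTop_atTop.atTop_mul_atTop₀ <| tendsto_atTop_add_const_right _ _ <|
      ((tendsto_rpow_atTop (by linarith)).comp tendsto_natCast_atTop_atTop).const_mul_atTop hT
  refine tendsto_atTop_mono' _ ?_
    ((Real.tendsto_exp_atTop.comp hexponent).const_mul_atTop (one_half_pos (α := ℝ)))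
  filter_upwards [eventually_gt_atTop 0] with m hm
  have hm0 : (0 : ℝ) < m := by exact_mod_cast hm
  have hsqrt : √((m : ℝ) ^ s) = m * (m : ℝ) ^ (s / 2 - 1) := by
    rw [Real.sqrt_eq_rpow, ← Real.rpow_mul hm0.le, Real.rpow_sub_one hm0.ne']
    field_simp
  calc 1 / 2 * Real.exp (m * (T * (m : ℝ) ^ (s / 2 - 1) + -1))
      = Real.exp (-m) * (Real.exp (T * √((m : ℝ) ^ s)) / 2) := by
        rw [hsqrt, mul_add, Real.exp_add]
        ring_nf
    _ ≤ _ := by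
        rw [Real.cosh_eq]
        gcongr
        exact le_add_of_nonneg_right (Real.exp_pos _).le

theorem not_isCauchySolutionOn_expSum {s : ℝ} (hs : 2 < s) {S : Set (ℝ × ℝ)}
    (hS : UniqueDiffOn ℝ S) {T δ : ℝ} (hT : 0 < T) (hδ : 0 < δ)
    (hsub : Icc 0 T ×ˢ Icc (-δ) δ ⊆ S) (u : ℝ × ℝ → ℂ) :
    ¬ IsCauchySolutionOn S (expSum (fun j : ℕ => Real.exp (-j)) fun j => (j : ℝ) ^ s) 0 u := by
  intro h
  obtain ⟨χ, hχ, hχs, hpos, hpos0⟩ := exists_gevreyCutoff hδ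
  obtain ⟨τ, hτ, hτT, hτsmall⟩ : ∃ τ, 0 < τ ∧ τ ≤ T ∧ (18 + 1) * τ ^ 2 < 1 :=
    ⟨min T (1 / 5), by positivity, min_le_left _ _, by
      nlinarith [min_le_right T (1 / 5), lt_min hT (by norm_num : (0 : ℝ) < 1 / 5)]⟩
  have hrect : Icc 0 τ ×ˢ uIcc (-δ) δ ⊆ S := by
    rw [uIcc_of_le (by linarith)]
    exact (prod_mono_left (Icc_subset_Icc_right hτT)).trans hsub
  have hle := h.mul_cosh_mul_re_fourier_le hS hτ.le hrect Real.summable_exp_neg_nat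
    (fun j => (Real.exp_pos _).le) (fun j => by positivity) hχ (by norm_num) hτsmall hχs hpos
  obtain ⟨m, hm⟩ := (((tendsto_exp_neg_mul_cosh_sqrt hs hτ).atTop_mul_const
    hpos0).eventually_gt_atTop |∫ x in (-δ)..δ, ‖u (τ, x) * χ x‖|).exists
  exact (hle m).not_gt hm

theorem not_locallySolvableAtOrigin {s : ℝ} (hs : 2 < s) {A : Set (ℝ → ℂ)}
    (hφ : expSum (fun j : ℕ => Real.exp (-j)) (fun j => (j : ℝ) ^ s) ∈ A) (h0 : 0 ∈ A) :
    ¬ LocallySolvableAtOrigin modelOperator A := by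
  intro h
  obtain ⟨U, hU, hU0, u, hu⟩ := h.exists_isCauchySolutionOn hφ h0
  obtain ⟨ε, hε, hball⟩ := Metric.nhds_basis_closedBall.mem_iff.mp (hU.mem_nhds hU0)
  refine not_isCauchySolutionOn_expSum hs hU.uniqueDiffOn hε hε (Subset.trans ?_ hball) u hu
  rw [← closedBall_prod_same, Real.closedBall_eq_Icc, zero_sub, zero_add]
  exact prod_mono_left (Icc_subset_Icc_left (neg_nonpos.mpr hε.le))

theorem mainTheorem3 :
    (∀ s : ℝ, 2 < s → ¬ LocallySolvableAtOrigin modelOperator (gevreyClass s)) ∧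
    ¬ LocallySolvableAtOrigin modelOperator smoothClass ∧
    (∀ T : ℝ, 0 < T → ¬ SmoothlySolvableOnStrip T) := by
  have hsmooth := (uniformGevrey_expSum (s := 3) (by norm_num)).contDiff
  have hzero : (0 : ℝ → ℂ) ∈ smoothClass := (UniformGevrey.zero (s := 3) (a := 1)).contDiff
  refine ⟨fun s hs => ?_, not_locallySolvableAtOrigin (s := 3) (by norm_num) hsmooth hzero,
    fun T hT h => ?_⟩
  · have hs0 : 0 < s := by linarith
    exact not_locallySolvableAtOrigin hs
      ((uniformGevrey_expSum hs0).mem_gevreyClass (by positivity))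
      (UniformGevrey.zero.mem_gevreyClass one_pos)
  · obtain ⟨u, hu⟩ := h.exists_isCauchySolutionOn hT hsmooth hzero
    exact not_isCauchySolutionOn_expSum (by norm_num)
      ((uniqueDiffOn_Icc hT).prod uniqueDiffOn_univ) hT one_pos
      (prod_mono_right (subset_univ _)) u hu
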